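/- There are absolute constants $K, C, D, d > 0$ such that the following holds. Let $n, m, r \ge 1$ be integers, let $A_1,\dots,A_m \in \mathbb{R}^{n\times n}$, and let $\mathcal{A} : \mathbb{R}^{n\times n} \to \mathbb{R}^m$ be given by $\mathcal{A}(X)_i = \operatorname{Tr}(A_i^{\top} X)$, with adjoint $\mathcal{A}^*(v) = \sum_{i=1}^m v_i A_i$. Let $\delta_{4r}$ be the smallest number $\delta$ such that $(1-\delta)\|X\|_F^2 \le \|\mathcal{A}(X)\|_2^2 \le (1+\delta)\|X\|_F^2$ for all $X \in \mathbb{R}^{n\times n}$ of rank at most $4r$, and suppose that $\delta_{4r} < \sqrt{2}-1$. Let $M \in \mathbb{R}^{n\times n}$ have rank $r$, let $\sigma \ge 0$, and let $y = \mathcal{A}(M) + z$, where $z = (z_1,\dots,z_m)$ has independent Gaussian entries with mean $0$ and variance $\sigma^2$. Put $\lambda = K\sqrt{n}\,\sigma$ and consider the matrix Dantzig selector $$\text{minimize } \|X\|_* \quad \text{subject to} \quad \|\mathcal{A}^*(y - \mathcal{A}(X))\| \le \lambda,$$ where $\|\cdot\|_*$ is the nuclear norm and $\|\cdot\|$ the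 operator norm (largest singular value). Then, with probability at least $1 - D e^{-dn}$, this problem has a solution, and every solution $\hat M$ satisfies $$\|\hat M - M\|_F^2 \le C\, n\, r\, \sigma^2 .$$ -/

import Mathlib

open MeasureTheory ProbabilityTheory
open scoped NNReal

namespace MatrixRecovery

/-- The measurement operator `𝒜 : ℝ^{n×n} → ℝ^m`, `𝒜(X)_i = ⟨A_i, X⟩ = Tr(A_iᵀ X)`. -/
def measure {n m : ℕ} (A : Fin m → Matrix (Fin n) (Fin n) ℝ)
    (X : Matrix (Fin n) (Fin n) ℝ) : Fin m → ℝ :=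
  fun i => ((A i).transpose * X).trace

/-- The adjoint `𝒜^* : ℝ^m → ℝ^{n×n}`, `𝒜^*(v) = ∑ i, v_i A_i`. -/
def adjointMeasure {n m : ℕ} (A : Fin m → Matrix (Fin n) (Fin n) ℝ)
    (v : Fin m → ℝ) : Matrix (Fin n) (Fin n) ℝ :=
  ∑ i, v i • A i

/-- The Frobenius norm. -/
noncomputable def frobNorm {n : ℕ} (X : Matrix (Fin n) (Fin n) ℝ) : ℝ :=
  √(∑ i, ∑ j, X i j ^ 2)

/-- The operator norm with respect to the Euclidean norm, i.e. the largest singular value. -/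
noncomputable def opNorm {n : ℕ} (X : Matrix (Fin n) (Fin n) ℝ) : ℝ :=
  ‖Matrix.toEuclideanCLM (n := Fin n) (𝕜 := ℝ) X‖

/-- The nuclear norm: the sum of the `n` singular values, with multiplicity. -/
noncomputable def nuclearNorm {n : ℕ} (X : Matrix (Fin n) (Fin n) ℝ) : ℝ :=
  ∑ i ∈ Finset.range n, (Matrix.toEuclideanLin X).singularValues i

/-- `δ` is the isometry constant `δ_k` of `𝒜`: the smallest real number such that
`(1 - δ) ‖X‖_F² ≤ ‖𝒜(X)‖² ≤ (1 + δ) ‖X‖_F²` for all matrices `X` of rank at most `k`. -/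
def IsIsometryConstant {n m : ℕ} (A : Fin m → Matrix (Fin n) (Fin n) ℝ) (k : ℕ) (δ : ℝ) : Prop :=
  IsLeast {δ : ℝ | ∀ X : Matrix (Fin n) (Fin n) ℝ, X.rank ≤ k →
    (1 - δ) * frobNorm X ^ 2 ≤ ∑ i, measure A X i ^ 2 ∧
      ∑ i, measure A X i ^ 2 ≤ (1 + δ) * frobNorm X ^ 2} δ

/-- Feasibility for the matrix Dantzig selector with data `y` and tolerance `lam`:
`‖𝒜^*(y - 𝒜(X))‖ ≤ lam` in operator norm. -/
def DantzigFeasible {n m : ℕ} (A : Fin m → Matrix (Fin n) (Fin n) ℝ) (y : Fin m → ℝ) (lam : ℝ)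
    (X : Matrix (Fin n) (Fin n) ℝ) : Prop :=
  opNorm (adjointMeasure A (y - measure A X)) ≤ lam

/-- `X` solves the matrix Dantzig selector: it is feasible and has the smallest nuclear norm
among all feasible matrices. -/
def IsDantzigSolution {n m : ℕ} (A : Fin m → Matrix (Fin n) (Fin n) ℝ) (y : Fin m → ℝ) (lam : ℝ)
    (X : Matrix (Fin n) (Fin n) ℝ) : Prop :=
  DantzigFeasible A y lam X ∧
    ∀ X' : Matrix (Fin n) (Fin n) ℝ, DantzigFeasible A y lam X' → nuclearNorm X ≤ nuclearNorm X'

end MatrixRecovery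

/-! Write `H` for the error of a solution. If the noise satisfies `‖𝒜^*(z)‖ ≤ λ`, then `M` is
feasible, so a solution has nuclear norm at most that of `M`, and the triangle inequality gives
`‖𝒜^*𝒜(H)‖ ≤ 2λ`. The rest is deterministic, apart from bounding the noise.

Duality against a subgradient of the nuclear norm at `M` turns the descent condition into `H = H₀ +
Hc`, with `H₀` of rank at most `2r` and `‖Hc‖_* ≤ √r ‖H₀‖_F` (`exists_cone_decomposition`). Cutting
`Hc` along its singular values into blocks of rank `2r` makes the Frobenius norms of all blocks but
the first summable (`exists_block_decomposition`). Let `Y` be `H₀` plus the first block. Then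
`‖𝒜(Y)‖²` is `⟨𝒜(H), 𝒜(Y)⟩` minus cross terms with the later blocks; the former is controlled by
duality, the latter by restricted isometry for orthogonal matrices. This bounds `‖Y‖_F`, which
dominates `‖H‖_F` up to a constant (`RestrictedIsometry.frobNorm_sq_le`).

For the noise, each `uᵀ 𝒜^*(z) v` is a Gaussian sum whose variance restricted isometry bounds on
rank-one matrices; a union bound over a net of pairs controls the operator norm
(`measureReal_lt_opNorm_adjointMeasure_le`). Existence of a solution is compactness. -/

namespace MatrixRecovery

open Matrix

/-! ### Singular values, norms and their duality -/

section LinearAlgebra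

variable {n : ℕ}

/-- The Frobenius inner product `⟨X, Y⟩ = Tr(Xᵀ Y)`. -/
def frobInner (X Y : Matrix (Fin n) (Fin n) ℝ) : ℝ := (Xᵀ * Y).trace

/-- The singular values of a square matrix, in decreasing order and extended by zero. -/
noncomputable def singVal (X : Matrix (Fin n) (Fin n) ℝ) (i : ℕ) : ℝ :=
  (Matrix.toEuclideanLin X).singularValues i

lemma frobInner_eq_sum (X Y : Matrix (Fin n) (Fin n) ℝ) :
    frobInner X Y = ∑ i, ∑ j, X i j * Y i j := by
  rw [Finset.sum_comm]
  simp [frobInner, Matrix.trace, Matrix.mul_apply]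

lemma frobInner_comm (X Y : Matrix (Fin n) (Fin n) ℝ) : frobInner X Y = frobInner Y X := by
  simp [frobInner_eq_sum, mul_comm]

@[simp] lemma frobInner_add_right (X Y Z : Matrix (Fin n) (Fin n) ℝ) :
    frobInner X (Y + Z) = frobInner X Y + frobInner X Z := by
  simp [frobInner, Matrix.mul_add]

@[simp] lemma frobInner_sub_right (X Y Z : Matrix (Fin n) (Fin n) ℝ) :
    frobInner X (Y - Z) = frobInner X Y - frobInner X Z := by
  simp [frobInner, Matrix.mul_sub]

@[simp] lemma frobInner_smul_right (c : ℝ) (X Y : Matrix (Fin n) (Fin n) ℝ) :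
    frobInner X (c • Y) = c * frobInner X Y := by
  simp [frobInner]

@[simp] lemma frobInner_zero_right (X : Matrix (Fin n) (Fin n) ℝ) : frobInner X 0 = 0 := by
  simp [frobInner]

@[simp] lemma frobInner_add_left (X Y Z : Matrix (Fin n) (Fin n) ℝ) :
    frobInner (X + Y) Z = frobInner X Z + frobInner Y Z := by
  simp [frobInner, Matrix.add_mul]

@[simp] lemma frobInner_smul_left (c : ℝ) (X Y : Matrix (Fin n) (Fin n) ℝ) :
    frobInner (c • X) Y = c * frobInner X Y := by
  simp [frobInner]

lemma frobInner_sum_right {ι : Type*} (s : Finset ι) (X : Matrix (Fin n) (Fin n) ℝ)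
    (Y : ι → Matrix (Fin n) (Fin n) ℝ) :
    frobInner X (∑ i ∈ s, Y i) = ∑ i ∈ s, frobInner X (Y i) := by
  simp [frobInner, Matrix.mul_sum, Matrix.trace_sum]

lemma frobInner_mul_left (P X Y : Matrix (Fin n) (Fin n) ℝ) :
    frobInner (P * X) Y = frobInner X (Pᵀ * Y) := by
  simp [frobInner, Matrix.mul_assoc]

lemma frobInner_mul_right (Q X Y : Matrix (Fin n) (Fin n) ℝ) :
    frobInner (X * Q) Y = frobInner X (Y * Qᵀ) := by
  rw [frobInner, frobInner, Matrix.transpose_mul, Matrix.mul_assoc, Matrix.trace_mul_comm,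
    Matrix.mul_assoc]

lemma frobInner_diagonal_right (X : Matrix (Fin n) (Fin n) ℝ) (s : Fin n → ℝ) :
    frobInner X (diagonal s) = ∑ i, X i i * s i := by
  simp [frobInner, Matrix.trace]

lemma frobNorm_sq (X : Matrix (Fin n) (Fin n) ℝ) : frobNorm X ^ 2 = frobInner X X := by
  rw [frobNorm, Real.sq_sqrt (by positivity), frobInner_eq_sum]
  simp [sq]

lemma frobNorm_nonneg (X : Matrix (Fin n) (Fin n) ℝ) : 0 ≤ frobNorm X := Real.sqrt_nonneg _

lemma eq_zero_of_frobNorm_eq_zero {X : Matrix (Fin n) (Fin n) ℝ} (h : frobNorm X = 0) :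
    X = 0 := by
  rw [frobNorm, Real.sqrt_eq_zero (by positivity),
    Finset.sum_eq_zero_iff_of_nonneg (fun _ _ => by positivity)] at h
  ext i j
  have := h i (Finset.mem_univ _)
  rw [Finset.sum_eq_zero_iff_of_nonneg (fun _ _ => by positivity)] at this
  simpa using this j (Finset.mem_univ _)

lemma abs_frobInner_le (X Y : Matrix (Fin n) (Fin n) ℝ) :
    |frobInner X Y| ≤ frobNorm X * frobNorm Y := by
  apply abs_le_of_sq_le_sq _ (mul_nonneg (frobNorm_nonneg _) (frobNorm_nonneg _))
  rw [mul_pow, frobNorm_sq, frobNorm_sq]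
  simp only [frobInner_eq_sum, ← Finset.sum_product', ← sq]
  exact Finset.sum_mul_sq_le_sq_mul_sq _ _ _

lemma frobInner_orthogonal_conj {U V : Matrix (Fin n) (Fin n) ℝ} (hU : Uᵀ * U = 1)
    (hV : Vᵀ * V = 1) (X Y : Matrix (Fin n) (Fin n) ℝ) :
    frobInner (U * X * Vᵀ) (U * Y * Vᵀ) = frobInner X Y := by
  rw [frobInner_mul_right, frobInner_mul_left]
  congr 1
  calc Uᵀ * (U * Y * Vᵀ * Vᵀᵀ) = (Uᵀ * U) * Y * (Vᵀ * V) := by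
        simp only [Matrix.mul_assoc, Matrix.transpose_transpose]
    _ = Y := by simp [hU, hV]

lemma rank_add_le (X Y : Matrix (Fin n) (Fin n) ℝ) : (X + Y).rank ≤ X.rank + Y.rank := by
  unfold Matrix.rank
  rw [Matrix.mulVecLin_add]
  exact (Submodule.finrank_mono (LinearMap.range_add_le _ _)).trans
    (Submodule.finrank_add_le_finrank_add_finrank _ _)

lemma rank_smul_le (c : ℝ) (X : Matrix (Fin n) (Fin n) ℝ) : (c • X).rank ≤ X.rank := by
  have : c • X = (c • (1 : Matrix (Fin n) (Fin n) ℝ)) * X := by simp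
  rw [this]
  exact Matrix.rank_mul_le_right _ _

lemma singVal_nonneg (X : Matrix (Fin n) (Fin n) ℝ) (i : ℕ) : 0 ≤ singVal X i :=
  LinearMap.singularValues_nonneg _ i

lemma singVal_antitone (X : Matrix (Fin n) (Fin n) ℝ) : Antitone (singVal X) :=
  LinearMap.singularValues_antitone _

lemma singVal_eq_zero_of_le (X : Matrix (Fin n) (Fin n) ℝ) {i : ℕ} (hi : n ≤ i) :
    singVal X i = 0 :=
  LinearMap.singularValues_of_finrank_le _ (by simpa using hi)

lemma singVal_eq_zero_of_rank_le (X : Matrix (Fin n) (Fin n) ℝ) {i : ℕ} (hi : X.rank ≤ i) :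
    singVal X i = 0 := by
  refine (LinearMap.singularValues_eq_zero_iff_le_finrank_range _).2 (le_trans (le_of_eq ?_) hi)
  rw [Matrix.rank_eq_finrank_range_toLin X (EuclideanSpace.basisFun (Fin n) ℝ).toBasis
    (EuclideanSpace.basisFun (Fin n) ℝ).toBasis]
  rw [Matrix.toEuclideanLin_eq_toLin_orthonormal]

lemma nuclearNorm_eq_sum (X : Matrix (Fin n) (Fin n) ℝ) :
    nuclearNorm X = ∑ i : Fin n, singVal X i := by
  rw [nuclearNorm, Finset.sum_range]; rfl

/-- Singular value decomposition. -/
theorem exists_svd (X : Matrix (Fin n) (Fin n) ℝ) :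
    ∃ U V : Matrix (Fin n) (Fin n) ℝ, Uᵀ * U = 1 ∧ Vᵀ * V = 1 ∧
      X = U * diagonal (fun i : Fin n => singVal X i) * Vᵀ := by
  set T := Matrix.toEuclideanLin X with hT
  have hn : Module.finrank ℝ (EuclideanSpace ℝ (Fin n)) = n := by simp
  set b := T.isSymmetric_adjoint_comp_self.eigenvectorBasis hn with hb
  have hTb : ∀ i j, inner ℝ (T (b i)) (T (b j)) = if i = j then singVal X i ^ 2 else 0 := by
    intro i j
    rw [← LinearMap.adjoint_inner_right, ← LinearMap.comp_apply, hb,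
      LinearMap.IsSymmetric.apply_eigenvectorBasis, ← hb, real_inner_smul_right,
      b.inner_eq_ite]
    split_ifs with h
    · subst h
      simp only [singVal, mul_one]
      exact (T.sq_singularValues_fin hn i).symm
    · simp
  -- The images of the eigenvectors of `TᵀT` are orthogonal; those with nonzero singular value are
  -- normalised and completed to an orthonormal basis.
  let w : Fin n → EuclideanSpace ℝ (Fin n) := fun i => (singVal X i)⁻¹ • T (b i)
  have hw : Orthonormal ℝ (({i : Fin n | singVal X i ≠ 0} : Set (Fin n)).domRestrict w) := by
    rw [orthonormal_iff_ite]
    rintro ⟨i, hi⟩ ⟨j, hj⟩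
    simp only [Set.domRestrict_apply, w, real_inner_smul_left, real_inner_smul_right, hTb,
      Subtype.mk.injEq]
    split_ifs with h
    · subst h
      have : singVal X i ≠ 0 := hi
      field_simp
    · simp
  obtain ⟨c, hc⟩ := hw.exists_orthonormalBasis_extension_of_card_eq (by simp)
  have hTc : ∀ i, T (b i) = singVal X i • c i := by
    intro i
    by_cases h : singVal X i = 0
    · have := hTb i i
      simp only [h, if_true] at this
      simpa [h] using this
    · rw [hc i h, smul_smul, mul_inv_cancel₀ h, one_smul]
  have horth : ∀ e : OrthonormalBasis (Fin n) ℝ (EuclideanSpace ℝ (Fin n)),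
      (Matrix.of fun i j => e j i)ᵀ * (Matrix.of fun i j => e j i) = 1 := by
    intro e
    ext i j
    have := e.inner_eq_ite i j
    rw [EuclideanSpace.inner_eq_star_dotProduct] at this
    simpa [Matrix.mul_apply, dotProduct, Matrix.one_apply, mul_comm] using this
  refine ⟨Matrix.of fun i j => c j i, Matrix.of fun i j => b j i, horth c, horth b, ?_⟩
  have hXV : X * (Matrix.of fun i j => b j i) =
      (Matrix.of fun i j => c j i) * diagonal (fun i : Fin n => singVal X i) := by
    ext i j
    have := congrArg (fun v : EuclideanSpace ℝ (Fin n) => v i) (hTc j)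
    simpa [hT, Matrix.toLpLin_apply, Matrix.mulVec, dotProduct, Matrix.mul_apply,
      Matrix.diagonal_apply, mul_comm] using this
  rw [← hXV, Matrix.mul_assoc, mul_eq_one_comm.1 (horth b), Matrix.mul_one]

lemma dotProduct_mulVec_le_opNorm (W : Matrix (Fin n) (Fin n) ℝ) (x y : Fin n → ℝ) :
    x ⬝ᵥ (W *ᵥ y) ≤ opNorm W * (√(x ⬝ᵥ x) * √(y ⬝ᵥ y)) := by
  have hnorm : ∀ v : Fin n → ℝ, √(v ⬝ᵥ v) = ‖(WithLp.toLp 2 v : EuclideanSpace ℝ (Fin n))‖ := by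
    intro v
    rw [EuclideanSpace.norm_eq]; simp [dotProduct, sq]
  have h1 := real_inner_le_norm (WithLp.toLp 2 x : EuclideanSpace ℝ (Fin n))
    (Matrix.toEuclideanCLM (n := Fin n) (𝕜 := ℝ) W (WithLp.toLp 2 y))
  have h2 := (Matrix.toEuclideanCLM (n := Fin n) (𝕜 := ℝ) W).le_opNorm (WithLp.toLp 2 y)
  rw [Matrix.toEuclideanCLM_toLp] at h1 h2
  rw [EuclideanSpace.inner_toLp_toLp] at h1
  rw [hnorm, hnorm, opNorm]
  calc x ⬝ᵥ (W *ᵥ y) = (W *ᵥ y) ⬝ᵥ star x := by simp [dotProduct_comm]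
    _ ≤ _ := h1
    _ ≤ _ := mul_le_mul_of_nonneg_left h2 (norm_nonneg _)
    _ = _ := by ring

lemma opNorm_le_of_mulVec {W : Matrix (Fin n) (Fin n) ℝ} {c : ℝ} (hc : 0 ≤ c)
    (h : ∀ x, (W *ᵥ x) ⬝ᵥ (W *ᵥ x) ≤ c ^ 2 * (x ⬝ᵥ x)) : opNorm W ≤ c := by
  have hnorm : ∀ v : Fin n → ℝ, √(v ⬝ᵥ v) = ‖(WithLp.toLp 2 v : EuclideanSpace ℝ (Fin n))‖ := by
    intro v
    rw [EuclideanSpace.norm_eq]; simp [dotProduct, sq]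
  refine ContinuousLinearMap.opNorm_le_bound _ hc fun x => ?_
  obtain ⟨x, rfl⟩ : ∃ y, x = WithLp.toLp 2 y := ⟨x.ofLp, rfl⟩
  rw [Matrix.toEuclideanCLM_toLp, ← hnorm, ← hnorm]
  calc √((W *ᵥ x) ⬝ᵥ (W *ᵥ x)) ≤ √(c ^ 2 * (x ⬝ᵥ x)) := Real.sqrt_le_sqrt (h x)
    _ = c * √(x ⬝ᵥ x) := by rw [Real.sqrt_mul (by positivity), Real.sqrt_sq hc]

lemma opNorm_nonneg (W : Matrix (Fin n) (Fin n) ℝ) : 0 ≤ opNorm W := norm_nonneg _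

lemma opNorm_sub_le (X Y : Matrix (Fin n) (Fin n) ℝ) : opNorm (X - Y) ≤ opNorm X + opNorm Y := by
  unfold opNorm
  rw [map_sub]
  exact norm_sub_le _ _

lemma mulVec_dotProduct_mulVec (A B : Matrix (Fin n) (Fin n) ℝ) (x y : Fin n → ℝ) :
    (A *ᵥ x) ⬝ᵥ (B *ᵥ y) = x ⬝ᵥ ((Aᵀ * B) *ᵥ y) := by
  rw [← Matrix.mulVec_mulVec, Matrix.dotProduct_mulVec x Aᵀ, Matrix.vecMul_transpose]

/-- Duality between the operator norm and the nuclear norm. -/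
theorem frobInner_le_opNorm_mul_nuclearNorm (W X : Matrix (Fin n) (Fin n) ℝ) :
    frobInner W X ≤ opNorm W * nuclearNorm X := by
  obtain ⟨U, V, hU, hV, hX⟩ := exists_svd X
  have hcol : ∀ (U : Matrix (Fin n) (Fin n) ℝ), Uᵀ * U = 1 → ∀ i,
      (fun k => U k i) ⬝ᵥ (fun k => U k i) = 1 := by
    intro U hU i
    have := congrFun (congrFun hU i) i
    simpa [Matrix.mul_apply, dotProduct] using this
  -- Each diagonal entry is the bilinear form of `W` at a pair of unit singular vectors.
  have hdiag : ∀ i, (Uᵀ * W * V) i i ≤ opNorm W := by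
    intro i
    have h := dotProduct_mulVec_le_opNorm W (fun k => U k i) (fun k => V k i)
    rw [hcol U hU, hcol V hV] at h
    simp only [Real.sqrt_one, mul_one] at h
    refine le_trans (le_of_eq ?_) h
    rw [Matrix.mul_assoc]
    simp [Matrix.mul_apply, dotProduct, Matrix.mulVec]
  have : frobInner W X = ∑ i, (Uᵀ * W * V) i i * singVal X i := by
    rw [← frobInner_diagonal_right]
    conv_lhs => rw [hX]
    rw [frobInner_mul_right, frobInner_mul_left, Matrix.transpose_transpose, Matrix.mul_assoc,
      frobInner_comm, frobInner_mul_left, frobInner_comm, frobInner_mul_right]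
  rw [this, nuclearNorm_eq_sum, Finset.mul_sum]
  exact Finset.sum_le_sum fun i _ => mul_le_mul_of_nonneg_right (hdiag i) (singVal_nonneg X i)

/-- Equality case of the duality: `O = U Vᵀ` pairs with `X` to the trace of its singular values. -/
theorem exists_frobInner_eq_nuclearNorm (X : Matrix (Fin n) (Fin n) ℝ) :
    ∃ O : Matrix (Fin n) (Fin n) ℝ, Oᵀ * O = 1 ∧ frobInner O X = nuclearNorm X := by
  obtain ⟨U, V, hU, hV, hX⟩ := exists_svd X
  refine ⟨U * 1 * Vᵀ, ?_, ?_⟩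
  · have hV' : V * Vᵀ = 1 := mul_eq_one_comm.1 hV
    calc (U * 1 * Vᵀ)ᵀ * (U * 1 * Vᵀ) = V * (Uᵀ * U) * Vᵀ := by
          simp [Matrix.mul_assoc]
      _ = 1 := by simp [hU, hV']
  · conv_lhs => rw [hX]
    rw [frobInner_orthogonal_conj hU hV, frobInner_diagonal_right, nuclearNorm_eq_sum]
    simp

lemma frobInner_self_eq_sum_singVal (X : Matrix (Fin n) (Fin n) ℝ) :
    frobInner X X = ∑ i : Fin n, singVal X i ^ 2 := by
  obtain ⟨U, V, hU, hV, hX⟩ := exists_svd X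
  conv_lhs => rw [hX]
  rw [frobInner_orthogonal_conj hU hV, frobInner_diagonal_right]
  simp [sq]

lemma opNorm_le_one_of_orthogonal {O : Matrix (Fin n) (Fin n) ℝ} (hO : Oᵀ * O = 1) :
    opNorm O ≤ 1 := by
  refine opNorm_le_of_mulVec zero_le_one fun x => ?_
  rw [mulVec_dotProduct_mulVec, hO]; simp

lemma nuclearNorm_nonneg (X : Matrix (Fin n) (Fin n) ℝ) : 0 ≤ nuclearNorm X := by
  rw [nuclearNorm_eq_sum]; exact Finset.sum_nonneg fun i _ => singVal_nonneg X i

/-- The orthogonal `O` attaining the norm of the sum has operator norm at most one, so it pairs with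
each summand to at most that summand's nuclear norm. -/
lemma nuclearNorm_add_le (X Y : Matrix (Fin n) (Fin n) ℝ) :
    nuclearNorm (X + Y) ≤ nuclearNorm X + nuclearNorm Y := by
  obtain ⟨O, hO, h⟩ := exists_frobInner_eq_nuclearNorm (X + Y)
  have h1 := opNorm_le_one_of_orthogonal hO
  have hle : ∀ Z, frobInner O Z ≤ nuclearNorm Z := fun Z =>
    (frobInner_le_opNorm_mul_nuclearNorm O Z).trans
      (mul_le_of_le_one_left (nuclearNorm_nonneg Z) h1)
  rw [← h, frobInner_add_right]
  exact add_le_add (hle X) (hle Y)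

lemma frobNorm_le_nuclearNorm (X : Matrix (Fin n) (Fin n) ℝ) : frobNorm X ≤ nuclearNorm X := by
  apply le_of_sq_le_sq _ (nuclearNorm_nonneg X)
  rw [frobNorm_sq, frobInner_self_eq_sum_singVal, nuclearNorm_eq_sum]
  exact Finset.sum_sq_le_sq_sum_of_nonneg fun i _ => singVal_nonneg X i

lemma sum_fin_ite_mem (T : Finset ℕ) (f : ℕ → ℝ) (hf : ∀ i, n ≤ i → f i = 0) :
    ∑ i : Fin n, (if (i : ℕ) ∈ T then f i else 0) = ∑ i ∈ T, f i := by
  rw [← Finset.sum_range (fun i => if i ∈ T then f i else 0), Finset.sum_ite_mem]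
  refine Finset.sum_subset Finset.inter_subset_right fun i hi h => hf i ?_
  by_contra hlt
  exact h (Finset.mem_inter.2 ⟨Finset.mem_range.2 (by omega), hi⟩)

lemma sum_indicator_one_le (T : Finset ℕ) :
    ∑ i : Fin n, (if (i : ℕ) ∈ T then (1 : ℝ) else 0) ≤ T.card := by
  rw [← Finset.sum_range (fun i => if i ∈ T then (1 : ℝ) else 0), Finset.sum_ite_mem]
  simp only [Finset.sum_const, nsmul_eq_mul, mul_one, Nat.cast_le]
  exact Finset.card_le_card Finset.inter_subset_right

lemma rank_diagonal_ite_le (T : Finset ℕ) (f : ℕ → ℝ) :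
    (diagonal fun i : Fin n => if (i : ℕ) ∈ T then f i else 0).rank ≤ T.card := by
  rw [Matrix.rank_diagonal, ← Fintype.card_coe]
  refine Fintype.card_le_of_injective
    (fun i => (⟨i.1, by_contra fun h => i.2 (if_neg h)⟩ : T)) fun i j h => ?_
  exact Subtype.ext (Fin.ext (congrArg Subtype.val h))

/-- Cauchy–Schwarz against the indicator of the first `k` singular values; the others vanish. -/
lemma nuclearNorm_le_sqrt_rank (X : Matrix (Fin n) (Fin n) ℝ) {k : ℕ} (hk : X.rank ≤ k) :
    nuclearNorm X ≤ √k * frobNorm X := by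
  have hsum : nuclearNorm X =
      ∑ i : Fin n, (if (i : ℕ) ∈ Finset.range k then 1 else 0) * singVal X i := by
    rw [nuclearNorm_eq_sum]
    refine Finset.sum_congr rfl fun i _ => ?_
    split_ifs with h
    · simp
    · rw [singVal_eq_zero_of_rank_le X (hk.trans (by simpa using h))]; simp
  apply le_of_sq_le_sq _ (mul_nonneg (Real.sqrt_nonneg _) (frobNorm_nonneg X))
  rw [mul_pow, Real.sq_sqrt (Nat.cast_nonneg _), frobNorm_sq, frobInner_self_eq_sum_singVal, hsum]
  refine (Finset.sum_mul_sq_le_sq_mul_sq _ _ _).trans ?_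
  refine mul_le_mul_of_nonneg_right ?_ (Finset.sum_nonneg fun i _ => sq_nonneg _)
  have : ∀ i : Fin n, (if (i : ℕ) ∈ Finset.range k then (1 : ℝ) else 0) ^ 2 =
      if (i : ℕ) ∈ Finset.range k then 1 else 0 := fun i => by split_ifs <;> simp
  simp_rw [this]
  simpa using sum_indicator_one_le (n := n) (Finset.range k)

end LinearAlgebra

/-! ### Cone and block decompositions -/

section Decomposition

variable {n : ℕ}

/-- The matrix `K` supplies the positive semidefinite defect `1 - WᵀW`, so `W` is a contraction. -/
lemma opNorm_le_one_of_gram_add {W K : Matrix (Fin n) (Fin n) ℝ} (h : Wᵀ * W + Kᵀ * K = 1) :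
    opNorm W ≤ 1 := by
  refine opNorm_le_of_mulVec zero_le_one fun x => ?_
  have h1 : (W *ᵥ x) ⬝ᵥ (W *ᵥ x) + (K *ᵥ x) ⬝ᵥ (K *ᵥ x) = x ⬝ᵥ x := by
    rw [mulVec_dotProduct_mulVec, mulVec_dotProduct_mulVec, ← dotProduct_add, ← Matrix.add_mulVec,
      h, Matrix.one_mulVec]
  have h2 : 0 ≤ (K *ᵥ x) ⬝ᵥ (K *ᵥ x) := by
    simp only [dotProduct]; exact Finset.sum_nonneg fun i _ => mul_self_nonneg _
  linarith

/-- The polar factor `G` of a matrix of rank at most `r` with its left and right support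
projections `P` and `Q`. -/
theorem exists_polar_factor (M : Matrix (Fin n) (Fin n) ℝ) {r : ℕ} (hM : M.rank ≤ r) :
    ∃ P Q G : Matrix (Fin n) (Fin n) ℝ, Pᵀ = P ∧ P * P = P ∧ Qᵀ = Q ∧ Q * Q = Q ∧
      P * M = M ∧ M * Q = M ∧ P * G = G ∧ Gᵀ * G = Q ∧ frobInner G M = nuclearNorm M ∧
      frobNorm G ≤ √r ∧ P.rank ≤ r ∧ Q.rank ≤ r := by
  obtain ⟨U, V, hU, hV, hX⟩ := exists_svd M
  set S := diagonal (fun i : Fin n => singVal M i) with hS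
  set D : Matrix (Fin n) (Fin n) ℝ :=
    diagonal (fun i : Fin n => if (i : ℕ) ∈ Finset.range r then 1 else 0) with hD
  have hDt : Dᵀ = D := by simp [hD]
  have hDD : D * D = D := by simp [hD, Matrix.diagonal_mul_diagonal]
  have hs : ∀ i : Fin n, (if (i : ℕ) ∈ Finset.range r then (1 : ℝ) else 0) * singVal M i =
      singVal M i := by
    intro i
    split_ifs with h
    · simp
    · rw [singVal_eq_zero_of_rank_le M (hM.trans (by simpa using h))]; simp
  have hDS : D * S = S := by
    rw [hD, hS, Matrix.diagonal_mul_diagonal]; simp_rw [hs]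
  have hSD : S * D = S := by
    rw [hD, hS, Matrix.diagonal_mul_diagonal]; simp_rw [mul_comm (singVal M _), hs]
  have hDrank : D.rank ≤ r := by
    exact (rank_diagonal_ite_le (n := n) (Finset.range r) (fun _ => 1)).trans (by simp)
  have key : ∀ A B X Y Z : Matrix (Fin n) (Fin n) ℝ, Xᵀ * X = 1 →
      (Z * A * Xᵀ) * (X * B * Yᵀ) = Z * (A * B) * Yᵀ := by
    intro A B X Y Z h
    calc (Z * A * Xᵀ) * (X * B * Yᵀ) = Z * A * (Xᵀ * X) * B * Yᵀ := by
          simp only [Matrix.mul_assoc]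
      _ = _ := by rw [h]; simp only [Matrix.mul_assoc, Matrix.one_mul]
  have htr : ∀ A X Y : Matrix (Fin n) (Fin n) ℝ, (X * A * Yᵀ)ᵀ = Y * Aᵀ * Xᵀ := by
    intro A X Y; simp [Matrix.mul_assoc]
  refine ⟨U * D * Uᵀ, V * D * Vᵀ, U * D * Vᵀ, ?_, ?_, ?_, ?_, ?_, ?_, ?_, ?_, ?_, ?_, ?_, ?_⟩
  · rw [htr, hDt]
  · rw [key _ _ _ _ _ hU, hDD]
  · rw [htr, hDt]
  · rw [key _ _ _ _ _ hV, hDD]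
  · rw [hX, key _ _ _ _ _ hU, hDS]
  · rw [hX, key _ _ _ _ _ hV, hSD]
  · rw [key _ _ _ _ _ hU, hDD]
  · rw [htr, key _ _ _ _ _ hU, hDt, hDD]
  · conv_lhs => rw [hX]
    rw [frobInner_orthogonal_conj hU hV, hS, frobInner_diagonal_right, nuclearNorm_eq_sum]
    refine Finset.sum_congr rfl fun i _ => ?_
    rw [hD, Matrix.diagonal_apply_eq, hs]
  · apply Real.le_sqrt_of_sq_le
    rw [frobNorm_sq, frobInner_orthogonal_conj hU hV, frobInner, hDt, hDD]
    simpa [hD, Matrix.trace] using sum_indicator_one_le (n := n) (Finset.range r)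
  · exact ((Matrix.rank_mul_le_left _ _).trans (Matrix.rank_mul_le_right _ _)).trans hDrank
  · exact ((Matrix.rank_mul_le_left _ _).trans (Matrix.rank_mul_le_right _ _)).trans hDrank

/-- If `M` has rank at most `r` and `M + H` has no larger nuclear norm than `M`, then `H` splits
into a part of rank at most `2r` and an orthogonal part whose nuclear norm the first controls. -/
theorem exists_cone_decomposition (M H : Matrix (Fin n) (Fin n) ℝ) {r : ℕ} (hM : M.rank ≤ r)
    (h : nuclearNorm (M + H) ≤ nuclearNorm M) :
    ∃ H₀ Hc P Q : Matrix (Fin n) (Fin n) ℝ, H = H₀ + Hc ∧ H₀.rank ≤ 2 * r ∧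
      nuclearNorm Hc ≤ √r * frobNorm H₀ ∧ P * Hc = 0 ∧ Hc * Q = 0 ∧
      ∀ Y, P * Y = 0 → Y * Q = 0 → frobInner H₀ Y = 0 := by
  obtain ⟨P, Q, G, hPt, hPP, hQt, hQQ, hPM, hMQ, hPG, hGG, hGM, hGr, hPr, hQr⟩ :=
    exists_polar_factor M hM
  obtain ⟨P', hP'⟩ : ∃ P', P' = 1 - P := ⟨_, rfl⟩
  obtain ⟨Q', hQ'⟩ : ∃ Q', Q' = 1 - Q := ⟨_, rfl⟩
  have hP't : P'ᵀ = P' := by simp [hP', hPt]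
  have hQ't : Q'ᵀ = Q' := by simp [hQ', hQt]
  have hPP' : P * P' = 0 := by simp [hP', Matrix.mul_sub, hPP]
  have hP'P' : P' * P' = P' := by
    nth_rw 1 [hP']
    rw [Matrix.sub_mul, hPP', Matrix.one_mul, sub_zero]
  have hQ'Q : Q' * Q = 0 := by simp [hQ', Matrix.sub_mul, hQQ]
  have hQ'Q' : Q' * Q' = Q' := by
    nth_rw 2 [hQ']
    rw [Matrix.mul_sub, hQ'Q, Matrix.mul_one, sub_zero]
  have hP'M : P' * M = 0 := by simp [hP', Matrix.sub_mul, hPM]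
  have hP'G : P' * G = 0 := by simp [hP', Matrix.sub_mul, hPG]
  obtain ⟨O, hO, hOn⟩ := exists_frobInner_eq_nuclearNorm (P' * H * Q')
  -- `G + N` is the subgradient at `M`: `G` sees `M`, while `N` vanishes on `M` and attains the
  -- nuclear norm of the corner `P' H Q'`.
  obtain ⟨N, hN⟩ : ∃ N, N = P' * O * Q' := ⟨_, rfl⟩
  have hGN : Gᵀ * N = 0 := by
    have : Gᵀ * P' = 0 := by rw [← hP't, ← Matrix.transpose_mul, hP'G, Matrix.transpose_zero]
    rw [hN, ← Matrix.mul_assoc, ← Matrix.mul_assoc, this, Matrix.zero_mul, Matrix.zero_mul]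
  have hNG : Nᵀ * G = 0 := by
    rw [← Matrix.transpose_transpose G, ← Matrix.transpose_mul, hGN, Matrix.transpose_zero]
  have hNt : Nᵀ = Q' * Oᵀ * P' := by
    rw [hN, Matrix.transpose_mul, Matrix.transpose_mul, hP't, hQ't, Matrix.mul_assoc]
  have hW : opNorm (G + N) ≤ 1 := by
    -- `P O Q'` is the part of `O Q'` that compression by `P'` discards; with `N` it restores the
    -- Gram matrix `Q'`, and `GᵀG = Q` supplies the rest of the identity.
    apply opNorm_le_one_of_gram_add (K := P * O * Q')
    have hKt : (P * O * Q')ᵀ = Q' * Oᵀ * P := by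
      rw [Matrix.transpose_mul, Matrix.transpose_mul, hPt, hQ't, Matrix.mul_assoc]
    have h1 : Nᵀ * N + (P * O * Q')ᵀ * (P * O * Q') = Q' := by
      calc Nᵀ * N + (P * O * Q')ᵀ * (P * O * Q')
          = Q' * Oᵀ * (P' * P' + P * P) * O * Q' := by
            rw [hKt, hNt, hN]; noncomm_ring
        _ = Q' * (Oᵀ * O) * Q' := by
            rw [hP'P', hPP, hP', sub_add_cancel]; simp only [Matrix.mul_assoc, Matrix.one_mul]
        _ = Q' := by rw [hO, Matrix.mul_one, hQ'Q']
    rw [Matrix.transpose_add, Matrix.add_mul, Matrix.mul_add, Matrix.mul_add, hGN, hNG, hGG,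
      add_zero, zero_add, add_assoc, h1, hQ']
    simp
  have hdual : frobInner (G + N) (M + H) ≤ nuclearNorm (M + H) :=
    (frobInner_le_opNorm_mul_nuclearNorm _ _).trans
      (mul_le_of_le_one_left (nuclearNorm_nonneg _) hW)
  have hNM : frobInner N M = 0 := by
    rw [hN, Matrix.mul_assoc, frobInner_mul_left, hP't, hP'M, frobInner_zero_right]
  have hNH : frobInner N H = nuclearNorm (P' * H * Q') := by
    rw [hN, frobInner_mul_right, frobInner_mul_left, hP't, hQ't, ← Matrix.mul_assoc, hOn]
  have hsplit : H = (P * H + P' * H * Q) + P' * H * Q' := by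
    rw [hP', hQ']; noncomm_ring
  have hGc : frobInner G (P' * H * Q') = 0 := by
    rw [← hPG, frobInner_mul_left, hPt, Matrix.mul_assoc, ← Matrix.mul_assoc, hPP',
      Matrix.zero_mul, frobInner_zero_right]
  refine ⟨P * H + P' * H * Q, P' * H * Q', P, Q, hsplit, ?_, ?_, ?_, ?_, ?_⟩
  · refine (rank_add_le _ _).trans ?_
    have h1 := (Matrix.rank_mul_le_left P H).trans hPr
    have h2 := (Matrix.rank_mul_le_right (P' * H) Q).trans hQr
    omega
  -- Duality gives `‖M‖_* + ⟨G, H₀⟩ + ‖Hc‖_* ≤ ‖M‖_*`; Cauchy–Schwarz with `‖G‖_F ≤ √r` finishes.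
  · have h1 : frobInner G H = frobInner G (P * H + P' * H * Q) := by
      conv_lhs => rw [hsplit]
      rw [frobInner_add_right, hGc, add_zero]
    have h2 := (abs_le.1 (abs_frobInner_le G (P * H + P' * H * Q))).1
    have h3 := mul_le_mul_of_nonneg_right hGr (frobNorm_nonneg (P * H + P' * H * Q))
    rw [frobInner_add_left, frobInner_add_right, frobInner_add_right, hNM, hNH, hGM, h1] at hdual
    linarith
  · rw [Matrix.mul_assoc, ← Matrix.mul_assoc, hPP', Matrix.zero_mul]
  · rw [Matrix.mul_assoc, hQ'Q, Matrix.mul_zero]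
  · intro Y hPY hYQ
    rw [frobInner_add_left, frobInner_mul_left, hPt, hPY, frobInner_mul_right, hQt, hYQ,
      frobInner_zero_right, frobInner_zero_right, add_zero]

lemma sum_range_sum_Ico_mul (f : ℕ → ℝ) (k N : ℕ) :
    ∑ j ∈ Finset.range N, ∑ i ∈ Finset.Ico (k * j) (k * (j + 1)), f i =
      ∑ i ∈ Finset.range (k * N), f i := by
  induction N with
  | zero => simp
  | succ N ih =>
    rw [Finset.sum_range_succ, ih, Finset.sum_range_add_sum_Ico _ (by gcongr; omega)]

/-- Every entry of a block is at most the block's first entry, which is at most every entry of the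
preceding block. -/
lemma sqrt_sum_sq_Ico_le {s : ℕ → ℝ} (hs : Antitone s) (h0 : ∀ i, 0 ≤ s i) (k j : ℕ) :
    √(∑ i ∈ Finset.Ico (k * (j + 1)) (k * (j + 1 + 1)), s i ^ 2) * √k ≤
      ∑ i ∈ Finset.Ico (k * j) (k * (j + 1)), s i := by
  have h1 : ∑ i ∈ Finset.Ico (k * (j + 1)) (k * (j + 1 + 1)), s i ^ 2 ≤
      k * s (k * (j + 1)) ^ 2 := by
    refine (Finset.sum_le_card_nsmul _ _ (s (k * (j + 1)) ^ 2) fun i hi => ?_).trans (le_of_eq ?_)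
    · exact pow_le_pow_left₀ (h0 i) (hs (Finset.mem_Ico.1 hi).1) 2
    · simp [mul_add]
  have h2 : k * s (k * (j + 1)) ≤ ∑ i ∈ Finset.Ico (k * j) (k * (j + 1)), s i := by
    refine le_trans (le_of_eq ?_)
      (Finset.card_nsmul_le_sum _ _ (s (k * (j + 1))) fun i hi => ?_)
    · simp [mul_add]
    · exact hs (Finset.mem_Ico.1 hi).2.le
  refine le_trans ?_ h2
  rw [← Real.sqrt_mul (Finset.sum_nonneg fun i _ => sq_nonneg _)]
  apply Real.sqrt_le_iff.2 ⟨mul_nonneg (Nat.cast_nonneg _) (h0 _), ?_⟩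
  calc _ ≤ (k * s (k * (j + 1)) ^ 2) * (k : ℝ) :=
        mul_le_mul_of_nonneg_right h1 (Nat.cast_nonneg _)
    _ = _ := by ring

/-- Splitting of a matrix into orthogonal pieces of rank at most `k` along its decreasing sequence
of singular values. -/
theorem exists_block_decomposition (X : Matrix (Fin n) (Fin n) ℝ) {k : ℕ} (hk : 1 ≤ k) :
    ∃ B : ℕ → Matrix (Fin n) (Fin n) ℝ, X = B 0 + ∑ j ∈ Finset.range n, B (j + 1) ∧
      (∀ j, (B j).rank ≤ k) ∧
      (∑ j ∈ Finset.range n, frobNorm (B (j + 1))) * √k ≤ nuclearNorm X ∧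
      frobNorm X ^ 2 = frobNorm (B 0) ^ 2 + ∑ j ∈ Finset.range n, frobNorm (B (j + 1)) ^ 2 ∧
      (∀ P, P * X = 0 → ∀ j, P * B j = 0) ∧ (∀ Q, X * Q = 0 → ∀ j, B j * Q = 0) ∧
      ∀ i j, i ≠ j → frobInner (B i) (B j) = 0 := by
  obtain ⟨U, V, hU, hV, hX⟩ := exists_svd X
  let T : ℕ → Finset ℕ := fun j => Finset.Ico (k * j) (k * (j + 1))
  have hTcard : ∀ j, (T j).card = k := fun j => by simp [T, mul_add]
  have hTmem : ∀ i j, i ∈ T j ↔ i / k = j := by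
    intro i j
    rw [Finset.mem_Ico, Nat.div_eq_iff (by omega), mul_comm k j, mul_comm k (j + 1), Nat.succ_mul]
    omega
  let E : ℕ → Matrix (Fin n) (Fin n) ℝ := fun j =>
    diagonal fun i : Fin n => if (i : ℕ) ∈ T j then 1 else 0
  let S : ℕ → Matrix (Fin n) (Fin n) ℝ := fun j =>
    diagonal fun i : Fin n => if (i : ℕ) ∈ T j then singVal X i else 0
  have hsv : ∀ i, n ≤ i → singVal X i = 0 := fun i hi => singVal_eq_zero_of_le X hi
  -- Blocks `0, …, n` cover all `n` indices because `k ≥ 1`.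
  have hn : n ≤ k * (n + 1) := by nlinarith
  have hfrob : ∀ j, frobNorm (U * S j * Vᵀ) ^ 2 = ∑ i ∈ T j, singVal X i ^ 2 := by
    intro j
    rw [frobNorm_sq, frobInner_orthogonal_conj hU hV, frobInner_diagonal_right,
      ← sum_fin_ite_mem (n := n) (T j) (fun i => singVal X i ^ 2) (fun i hi => by simp [hsv i hi])]
    refine Finset.sum_congr rfl fun i _ => ?_
    simp only [S, Matrix.diagonal_apply_eq]
    split_ifs <;> ring
  have htotal : ∀ f : ℕ → ℝ, (∀ i, n ≤ i → f i = 0) →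
      ∑ i : Fin n, f i = ∑ j ∈ Finset.range (n + 1), ∑ i ∈ T j, f i := by
    intro f hf
    rw [sum_range_sum_Ico_mul, ← sum_fin_ite_mem (n := n) _ f hf]
    refine Finset.sum_congr rfl fun i _ => ?_
    rw [if_pos (Finset.mem_range.2 (i.2.trans_le hn))]
  refine ⟨fun j => U * S j * Vᵀ, ?_, ?_, ?_, ?_, ?_, ?_, ?_⟩
  · have hsum : diagonal (fun i : Fin n => singVal X i) = ∑ j ∈ Finset.range (n + 1), S j := by
      ext a b
      rw [Matrix.sum_apply]
      simp only [S, Matrix.diagonal_apply]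
      split_ifs with hab
      · simp only [hTmem]
        rw [Finset.sum_ite_eq, if_pos]
        exact Finset.mem_range.2 ((Nat.div_le_self _ _).trans_lt (by omega))
      · simp
    rw [add_comm, ← Finset.sum_range_succ' (fun j => U * S j * Vᵀ), ← Finset.sum_mul,
      ← Finset.mul_sum, ← hsum]
    exact hX
  · intro j
    refine ((Matrix.rank_mul_le_left _ _).trans (Matrix.rank_mul_le_right _ _)).trans ?_
    exact (rank_diagonal_ite_le (n := n) (T j) (singVal X)).trans (hTcard j).le
  · have hle : ∀ j, frobNorm (U * S (j + 1) * Vᵀ) * √k ≤ ∑ i ∈ T j, singVal X i := by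
      intro j
      rw [← Real.sqrt_sq (frobNorm_nonneg (U * S (j + 1) * Vᵀ)), hfrob]
      exact sqrt_sum_sq_Ico_le (singVal_antitone X) (singVal_nonneg X) k j
    rw [nuclearNorm_eq_sum, htotal _ hsv, Finset.sum_mul]
    refine (Finset.sum_le_sum fun j _ => hle j).trans ?_
    refine Finset.sum_le_sum_of_subset_of_nonneg (Finset.range_mono (Nat.le_succ n)) ?_
    exact fun j _ _ => Finset.sum_nonneg fun i _ => singVal_nonneg X i
  · rw [frobNorm_sq, frobInner_self_eq_sum_singVal,
      htotal (fun i => singVal X i ^ 2) (fun i hi => by simp [hsv i hi]), Finset.sum_range_succ',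
      add_comm]
    simp only [hfrob]
  · intro P hP j
    -- A block is `X` times a projection, so it inherits annihilation on the left; the mirrored
    -- factorisation below handles the right.
    have hUX : U * S j * Vᵀ = X * (V * E j * Vᵀ) := by
      have h1 : S j = diagonal (fun i : Fin n => singVal X i) * E j := by
        simp [S, E, Matrix.diagonal_mul_diagonal]
      calc U * S j * Vᵀ = U * diagonal (fun i : Fin n => singVal X i) * (Vᵀ * V) * E j * Vᵀ := by
            rw [hV, h1]; simp only [Matrix.mul_assoc, Matrix.one_mul]
        _ = (U * diagonal (fun i : Fin n => singVal X i) * Vᵀ) * (V * E j * Vᵀ) := by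
            simp only [Matrix.mul_assoc]
        _ = _ := by rw [← hX]
    change P * (U * S j * Vᵀ) = 0
    rw [hUX, ← Matrix.mul_assoc, hP, Matrix.zero_mul]
  · intro Q hQ j
    have hUX : U * S j * Vᵀ = (U * E j * Uᵀ) * X := by
      have h1 : S j = E j * diagonal (fun i : Fin n => singVal X i) := by
        simp [S, E, Matrix.diagonal_mul_diagonal]
      calc U * S j * Vᵀ = U * E j * (Uᵀ * U) * diagonal (fun i : Fin n => singVal X i) * Vᵀ := by
            rw [hU, h1]; simp only [Matrix.mul_assoc, Matrix.one_mul]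
        _ = (U * E j * Uᵀ) * (U * diagonal (fun i : Fin n => singVal X i) * Vᵀ) := by
            simp only [Matrix.mul_assoc]
        _ = _ := by rw [← hX]
    change (U * S j * Vᵀ) * Q = 0
    rw [hUX, Matrix.mul_assoc, hQ, Matrix.mul_zero]
  · intro i j hij
    rw [frobInner_orthogonal_conj hU hV, frobInner_diagonal_right]
    refine Finset.sum_eq_zero fun a _ => ?_
    simp only [S, Matrix.diagonal_apply_eq, hTmem]
    split_ifs with h1 h2
    · exact absurd (h1.symm.trans h2) hij
    all_goals simp

end Decomposition

/-! ### Pythagoras and scaling for the Frobenius norm -/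

section Orthogonal

variable {n : ℕ}

lemma frobNorm_add_sq_of_orthogonal {X Y : Matrix (Fin n) (Fin n) ℝ} (h : frobInner X Y = 0) :
    frobNorm (X + Y) ^ 2 = frobNorm X ^ 2 + frobNorm Y ^ 2 := by
  simp [frobNorm_sq, h, frobInner_comm Y X]

lemma frobNorm_smul_sq (c : ℝ) (X : Matrix (Fin n) (Fin n) ℝ) :
    frobNorm (c • X) ^ 2 = c ^ 2 * frobNorm X ^ 2 := by
  simp only [frobNorm_sq, frobInner_smul_left, frobInner_smul_right]
  ring

end Orthogonal

/-! ### Restricted isometry and the error bound -/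

section Recovery

variable {n m : ℕ} (A : Fin m → Matrix (Fin n) (Fin n) ℝ)

lemma measure_apply (X : Matrix (Fin n) (Fin n) ℝ) (i : Fin m) :
    measure A X i = frobInner (A i) X := rfl

lemma sum_mul_measure (v : Fin m → ℝ) (X : Matrix (Fin n) (Fin n) ℝ) :
    ∑ i, v i * measure A X i = frobInner (adjointMeasure A v) X := by
  simp only [measure_apply, adjointMeasure]
  rw [frobInner_comm, frobInner_sum_right]
  simp only [frobInner_smul_right]
  exact Finset.sum_congr rfl fun i _ => by rw [frobInner_comm]

lemma measure_add (X Y : Matrix (Fin n) (Fin n) ℝ) :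
    measure A (X + Y) = measure A X + measure A Y := by
  ext i; simp [measure_apply]

lemma measure_sub (X Y : Matrix (Fin n) (Fin n) ℝ) :
    measure A (X - Y) = measure A X - measure A Y := by
  ext i; simp [measure_apply]

lemma adjointMeasure_sub (v w : Fin m → ℝ) :
    adjointMeasure A (v - w) = adjointMeasure A v - adjointMeasure A w := by
  simp [adjointMeasure, sub_smul]

/-- The two-sided restricted isometry bound with constant `δ` at rank `k`. -/
def RestrictedIsometry (k : ℕ) (δ : ℝ) : Prop :=
  ∀ X : Matrix (Fin n) (Fin n) ℝ, X.rank ≤ k →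
    (1 - δ) * frobNorm X ^ 2 ≤ ∑ i, measure A X i ^ 2 ∧
      ∑ i, measure A X i ^ 2 ≤ (1 + δ) * frobNorm X ^ 2

variable {A}

lemma RestrictedIsometry.mono {k : ℕ} {δ δ' : ℝ} (h : RestrictedIsometry A k δ) (hδ : δ ≤ δ') :
    RestrictedIsometry A k δ' := fun X hX => by
  have := sq_nonneg (frobNorm X)
  obtain ⟨h1, h2⟩ := h X hX
  exact ⟨by nlinarith, by nlinarith⟩

/-- Orthogonal matrices of small total rank have almost orthogonal measurements. -/
lemma RestrictedIsometry.neg_inner_le {k : ℕ} {δ : ℝ} (h : RestrictedIsometry A k δ)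
    {X Y : Matrix (Fin n) (Fin n) ℝ} (hXY : X.rank + Y.rank ≤ k) (horth : frobInner X Y = 0) :
    -∑ i, measure A X i * measure A Y i ≤ δ * (frobNorm X * frobNorm Y) := by
  rcases (frobNorm_nonneg X).eq_or_lt with hx | hx
  · rw [eq_zero_of_frobNorm_eq_zero hx.symm]
    simp [measure_apply, frobNorm]
  rcases (frobNorm_nonneg Y).eq_or_lt with hy | hy
  · rw [eq_zero_of_frobNorm_eq_zero hy.symm]
    simp [measure_apply, frobNorm]
  set x := frobNorm X with hxd
  set y := frobNorm Y with hyd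
  -- Polarisation with `y X ± x Y`: the weights give both summands equal Frobenius norm, so that the
  -- constant is exactly `δ`.
  have hrank : ∀ c : ℝ, (y • X + c • Y).rank ≤ k := fun c =>
    (rank_add_le _ _).trans ((add_le_add (rank_smul_le _ _) (rank_smul_le _ _)).trans hXY)
  have hfrob : ∀ c : ℝ, frobNorm (y • X + c • Y) ^ 2 = y ^ 2 * x ^ 2 + c ^ 2 * y ^ 2 := by
    intro c
    rw [frobNorm_add_sq_of_orthogonal (by simp [horth]), frobNorm_smul_sq, frobNorm_smul_sq]
  have h1 := (h _ (hrank (-x))).2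
  have h2 := (h _ (hrank x)).1
  rw [hfrob] at h1 h2
  have hdiff : ∑ i, measure A (y • X + x • Y) i ^ 2 - ∑ i, measure A (y • X + (-x) • Y) i ^ 2 =
      4 * (x * y) * ∑ i, measure A X i * measure A Y i := by
    rw [Finset.mul_sum, ← Finset.sum_sub_distrib]
    refine Finset.sum_congr rfl fun i _ => ?_
    simp only [measure_apply, frobInner_add_right, frobInner_smul_right]
    ring
  have hpos : 0 < 4 * (x * y) := by positivity
  refine le_of_mul_le_mul_left ?_ hpos
  nlinarith

/-- Error bound for a direction `H` in the nuclear-norm descent cone of a rank-`r` matrix. -/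
theorem RestrictedIsometry.frobNorm_sq_le {r : ℕ} (hr : 1 ≤ r)
    (hA : RestrictedIsometry A (4 * r) 0.4143) {M H : Matrix (Fin n) (Fin n) ℝ} (hM : M.rank ≤ r)
    (hnuc : nuclearNorm (M + H) ≤ nuclearNorm M) {μ : ℝ}
    (hμ : opNorm (adjointMeasure A (measure A H)) ≤ μ) :
    frobNorm H ^ 2 ≤ 250 * r * μ ^ 2 := by
  obtain ⟨H₀, Hc, P, Q, hH, hrank, hcone, hP, hQ, hH₀⟩ := exists_cone_decomposition M H hM hnuc
  obtain ⟨B, hB, hBr, hBs, hBf, hBP, hBQ, hBo⟩ :=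
    exists_block_decomposition Hc (k := 2 * r) (by omega)
  have hH₀B : ∀ j, frobInner H₀ (B j) = 0 := fun j => hH₀ _ (hBP P hP j) (hBQ Q hQ j)
  have hμ0 : 0 ≤ μ := (opNorm_nonneg _).trans hμ
  have hR : (0 : ℝ) ≤ r := Nat.cast_nonneg r
  set a := frobNorm H₀ with ha
  set b := frobNorm (B 0) with hb
  set N := ∑ j ∈ Finset.range n, frobNorm (B (j + 1)) with hN
  set x := frobNorm (H₀ + B 0) with hx
  have ha0 : 0 ≤ a := frobNorm_nonneg _
  have hb0 : 0 ≤ b := frobNorm_nonneg _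
  have hx0 : 0 ≤ x := frobNorm_nonneg _
  have hN0 : 0 ≤ N := Finset.sum_nonneg fun _ _ => frobNorm_nonneg _
  have hxab : x ^ 2 = a ^ 2 + b ^ 2 := frobNorm_add_sq_of_orthogonal (hH₀B 0)
  -- Blocks of rank `2r` against the cone factor `√r` gain the factor `2`, which offsets `(a + b)² ≤
  -- 2x²` in `habN`.
  have hNa : 2 * N ^ 2 ≤ a ^ 2 := by
    have h1 : N * √(2 * r : ℕ) ≤ √r * a := hBs.trans hcone
    have h2 := pow_le_pow_left₀ (mul_nonneg hN0 (Real.sqrt_nonneg _)) h1 2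
    rw [mul_pow, mul_pow, Real.sq_sqrt (Nat.cast_nonneg _), Real.sq_sqrt hR] at h2
    push_cast at h2
    have hr' : (0 : ℝ) < r := by exact_mod_cast hr
    refine le_of_mul_le_mul_left ?_ hr'
    linarith
  have hYrank : (H₀ + B 0).rank ≤ 4 * r := by
    have := rank_add_le H₀ (B 0)
    have := hBr 0
    omega
  have hlow := (hA _ hYrank).1
  have hexp : ∑ i, measure A (H₀ + B 0) i ^ 2 =
      ∑ i, measure A H i * measure A (H₀ + B 0) i +
        ∑ j ∈ Finset.range n, (-∑ i, measure A H₀ i * measure A (B (j + 1)) i +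
          -∑ i, measure A (B 0) i * measure A (B (j + 1)) i) := by
    have hY : H = (H₀ + B 0) + ∑ j ∈ Finset.range n, B (j + 1) := by
      rw [hH]; nth_rw 1 [hB]; rw [add_assoc]
    have hY' : ∀ i, measure A H i =
        measure A (H₀ + B 0) i + ∑ j ∈ Finset.range n, measure A (B (j + 1)) i := by
      intro i
      rw [hY]
      simp only [measure_apply, frobInner_add_right, frobInner_sum_right]
    simp only [← Finset.sum_neg_distrib, ← Finset.sum_add_distrib]
    rw [Finset.sum_comm, ← Finset.sum_add_distrib]
    refine Finset.sum_congr rfl fun i _ => ?_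
    rw [hY', measure_add, add_mul, Finset.sum_mul, Pi.add_apply, add_assoc,
      ← Finset.sum_add_distrib]
    rw [Finset.sum_eq_zero fun j _ => by ring]
    ring
  have hnoise : ∑ i, measure A H i * measure A (H₀ + B 0) i ≤ 2 * μ * √r * x := by
    rw [sum_mul_measure]
    refine (frobInner_le_opNorm_mul_nuclearNorm _ _).trans ?_
    calc _ ≤ μ * (√(4 * r : ℕ) * x) :=
          mul_le_mul hμ (nuclearNorm_le_sqrt_rank _ hYrank) (nuclearNorm_nonneg _) hμ0
      _ = _ := by
          push_cast
          rw [Real.sqrt_mul (by norm_num), show (4 : ℝ) = 2 ^ 2 by norm_num,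
            Real.sqrt_sq (by norm_num)]
          ring
  have hcross : ∑ j ∈ Finset.range n, (-∑ i, measure A H₀ i * measure A (B (j + 1)) i +
      -∑ i, measure A (B 0) i * measure A (B (j + 1)) i) ≤ 0.4143 * ((a + b) * N) := by
    rw [hN, Finset.mul_sum, Finset.mul_sum]
    refine Finset.sum_le_sum fun j _ => ?_
    have hj := hBr (j + 1)
    have hj0 := hBr 0
    have h1 := hA.neg_inner_le (X := H₀) (Y := B (j + 1)) (by omega) (hH₀B _)
    have h2 := hA.neg_inner_le (X := B 0) (Y := B (j + 1)) (by omega) (hBo _ _ (by omega))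
    rw [← ha] at h1
    rw [← hb] at h2
    linarith
  have habN : (a + b) * N ≤ x ^ 2 := by
    apply le_of_sq_le_sq _ (sq_nonneg x)
    have h1 : (a + b) ^ 2 ≤ 2 * x ^ 2 := by nlinarith [sq_nonneg (a - b)]
    have h2 : 2 * N ^ 2 ≤ x ^ 2 := by nlinarith [sq_nonneg b]
    calc ((a + b) * N) ^ 2 = (a + b) ^ 2 * N ^ 2 := by ring
      _ ≤ 2 * x ^ 2 * N ^ 2 := mul_le_mul_of_nonneg_right h1 (sq_nonneg _)
      _ = x ^ 2 * (2 * N ^ 2) := by ring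
      _ ≤ x ^ 2 * x ^ 2 := mul_le_mul_of_nonneg_left h2 (sq_nonneg _)
      _ = _ := by ring
  -- `0.1714 = 1 - 2 · 0.4143`: one `δ` comes from the lower isometry bound, the other from the
  -- cross terms. Any `δ` bounded away from `1/2` would do.
  have hmain : 0.1714 * x ≤ 2 * μ * √r := by
    rcases hx0.eq_or_lt with h0 | h0
    · rw [← h0]; simp; positivity
    · refine le_of_mul_le_mul_right ?_ h0
      rw [hexp] at hlow
      nlinarith
  have hxsq : 0.02937 * x ^ 2 ≤ 4 * (μ ^ 2 * r) := by
    have h1 := pow_le_pow_left₀ (by positivity) hmain 2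
    have h2 : (2 * μ * √r) ^ 2 = 4 * (μ ^ 2 * r) := by
      rw [mul_pow, Real.sq_sqrt hR]; ring
    rw [h2] at h1
    nlinarith [sq_nonneg x]
  have htot : frobNorm H ^ 2 = a ^ 2 + frobNorm Hc ^ 2 := by
    rw [hH, frobNorm_add_sq_of_orthogonal (hH₀ _ hP hQ)]
  have hBN : ∑ j ∈ Finset.range n, frobNorm (B (j + 1)) ^ 2 ≤ N ^ 2 :=
    Finset.sum_sq_le_sq_sum_of_nonneg fun _ _ => frobNorm_nonneg _
  -- `‖H‖_F² ≤ x² + N² ≤ (3/2) x²`, and `(3/2) · 4 / 0.02937 < 250`.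
  nlinarith [sq_nonneg b, mul_nonneg (sq_nonneg μ) hR]

end Recovery

/-! ### Existence of a minimiser -/

section Existence

variable {n m : ℕ}

lemma continuous_frobNorm : Continuous (frobNorm (n := n)) := by
  unfold frobNorm
  fun_prop

lemma continuous_opNorm : Continuous (opNorm (n := n)) := by
  unfold opNorm
  exact (LinearMap.continuous_of_finiteDimensional
    ((Matrix.toEuclideanCLM (n := Fin n) (𝕜 := ℝ)).toAlgEquiv.toLinearMap)).norm

/-- By the triangle inequality and the rank bound, it is `√n`-Lipschitz for the Frobenius norm. -/
lemma continuous_nuclearNorm : Continuous (nuclearNorm (n := n)) := by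
  rw [continuous_iff_continuousAt]
  intro X
  have hle : ∀ Y Z : Matrix (Fin n) (Fin n) ℝ,
      nuclearNorm Y - nuclearNorm Z ≤ √n * frobNorm (Y - Z) := by
    intro Y Z
    have h1 := nuclearNorm_add_le (Y - Z) Z
    have h2 := nuclearNorm_le_sqrt_rank (Y - Z) (Matrix.rank_le_height _)
    rw [sub_add_cancel] at h1
    linarith
  have hsymm : ∀ Y Z : Matrix (Fin n) (Fin n) ℝ, frobNorm (Y - Z) = frobNorm (Z - Y) := by
    intro Y Z
    simp only [frobNorm, Matrix.sub_apply]
    congr 1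
    exact Finset.sum_congr rfl fun i _ => Finset.sum_congr rfl fun j _ => by ring
  have hlim : Filter.Tendsto (fun Y => √n * frobNorm (Y - X)) (nhds X) (nhds 0) := by
    have : Continuous fun Y : Matrix (Fin n) (Fin n) ℝ => √n * frobNorm (Y - X) :=
      continuous_const.mul (continuous_frobNorm.comp (continuous_id.sub continuous_const))
    have h := this.tendsto X
    simpa [frobNorm] using h
  rw [ContinuousAt, tendsto_iff_dist_tendsto_zero]
  refine squeeze_zero (fun _ => dist_nonneg) (fun Y => ?_) hlim
  rw [Real.dist_eq, abs_sub_le_iff]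
  exact ⟨hle Y X, (hle X Y).trans_eq (by rw [hsymm])⟩

lemma abs_apply_le_frobNorm (X : Matrix (Fin n) (Fin n) ℝ) (i j : Fin n) :
    |X i j| ≤ frobNorm X := by
  apply Real.abs_le_sqrt
  refine le_trans ?_ (Finset.single_le_sum (f := fun i => ∑ j, X i j ^ 2)
    (fun _ _ => by positivity) (Finset.mem_univ i))
  exact Finset.single_le_sum (f := fun j => X i j ^ 2) (fun _ _ => by positivity)
    (Finset.mem_univ j)

lemma isCompact_nuclearNorm_le (c : ℝ) :
    IsCompact {X : Matrix (Fin n) (Fin n) ℝ | nuclearNorm X ≤ c} := by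
  have hbox : IsCompact (Set.univ.pi fun _ : Fin n => Set.univ.pi fun _ : Fin n =>
      Set.Icc (-c) c) := isCompact_univ_pi fun _ => isCompact_univ_pi fun _ => isCompact_Icc
  refine IsCompact.of_isClosed_subset hbox
    (isClosed_le continuous_nuclearNorm continuous_const) fun X hX i _ j _ => ?_
  exact abs_le.1 ((abs_apply_le_frobNorm X i j).trans ((frobNorm_le_nuclearNorm X).trans hX))

/-- Only feasible matrices with nuclear norm at most that of `M` matter, and these form a compact
set. -/
theorem exists_isDantzigSolution (A : Fin m → Matrix (Fin n) (Fin n) ℝ) (y : Fin m → ℝ) (lam : ℝ)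
    {M : Matrix (Fin n) (Fin n) ℝ} (hM : DantzigFeasible A y lam M) :
    ∃ X, IsDantzigSolution A y lam X := by
  have hcont : Continuous fun X => opNorm (adjointMeasure A (y - measure A X)) := by
    refine continuous_opNorm.comp ?_
    unfold adjointMeasure measure
    simp only [Pi.sub_apply]
    fun_prop
  have hcpt : IsCompact ({X | nuclearNorm X ≤ nuclearNorm M} ∩ {X | DantzigFeasible A y lam X}) :=
    (isCompact_nuclearNorm_le _).inter_right (isClosed_le hcont continuous_const)
  obtain ⟨X, hX, hmin⟩ := hcpt.exists_isMinOn ⟨M, le_refl (nuclearNorm M), hM⟩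
    continuous_nuclearNorm.continuousOn
  refine ⟨X, hX.2, fun X' hX' => ?_⟩
  by_cases h : nuclearNorm X' ≤ nuclearNorm M
  · exact hmin ⟨h, hX'⟩
  · exact le_trans hX.1 (not_le.1 h).le

end Existence

/-! ### Recovery when the noise is feasible -/

section Deterministic

variable {n m : ℕ} {A : Fin m → Matrix (Fin n) (Fin n) ℝ}

/-- On the event that the noise is feasible, every solution of the Dantzig selector is close to
the true matrix. -/
theorem IsDantzigSolution.frobNorm_sub_sq_le {r : ℕ} (hr : 1 ≤ r)
    (hA : RestrictedIsometry A (4 * r) 0.4143) {M X : Matrix (Fin n) (Fin n) ℝ} (hM : M.rank ≤ r)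
    {v : Fin m → ℝ} {lam : ℝ} (hv : opNorm (adjointMeasure A v) ≤ lam)
    (hX : IsDantzigSolution A (measure A M + v) lam X) :
    frobNorm (X - M) ^ 2 ≤ 1000 * r * lam ^ 2 := by
  have hfeas : DantzigFeasible A (measure A M + v) lam M := by
    simpa [DantzigFeasible] using hv
  have hH : measure A (X - M) = v - (measure A M + v - measure A X) := by
    rw [measure_sub]; abel
  have hop : opNorm (adjointMeasure A (measure A (X - M))) ≤ 2 * lam := by
    rw [hH, adjointMeasure_sub]
    have := hX.1
    unfold DantzigFeasible at this
    linarith [opNorm_sub_le (adjointMeasure A v)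
      (adjointMeasure A (measure A M + v - measure A X))]
  have := hA.frobNorm_sq_le hr hM (H := X - M) (by
    rw [add_sub_cancel]; exact hX.2 M hfeas) hop
  linarith

end Deterministic

/-! ### Nets and operator norms -/

section Net

variable {E : Type*} [NormedAddCommGroup E] [InnerProductSpace ℝ E]

/-- The unit ball of a finite-dimensional space has a `1/2`-net of at most `5 ^ dim` points. -/
theorem exists_half_net [FiniteDimensional ℝ E] : ∃ N : Finset E, N.card ≤ 5 ^ Module.finrank ℝ E ∧
    (∀ u ∈ N, ‖u‖ ≤ 1) ∧ ∀ x : E, ‖x‖ ≤ 1 → ∃ u ∈ N, ‖x - u‖ ≤ 1 / 2 := by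
  classical
  -- A `1/2`-separated set of maximal size is a net. Doubling it gives a `1`-separated set in the
  -- ball of radius `2`, hence the bound `5 ^ dim`.
  let Sep : Finset E → Prop := fun N =>
    (∀ u ∈ N, ‖u‖ ≤ 1) ∧ ∀ u ∈ N, ∀ v ∈ N, u ≠ v → 1 / 2 ≤ ‖u - v‖
  have hcard : ∀ N, Sep N → N.card ≤ 5 ^ Module.finrank ℝ E := by
    rintro N ⟨h1, h2⟩
    have hinj : Function.Injective fun x : E => (2 : ℝ) • x :=
      smul_right_injective E two_ne_zero
    rw [← Finset.card_image_of_injective N hinj]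
    refine Besicovitch.card_le_of_separated _ ?_ ?_
    · intro c hc
      obtain ⟨u, hu, rfl⟩ := Finset.mem_image.1 hc
      rw [norm_smul]; norm_num; linarith [h1 u hu]
    · intro c hc d hd hcd
      obtain ⟨u, hu, rfl⟩ := Finset.mem_image.1 hc
      obtain ⟨v, hv, rfl⟩ := Finset.mem_image.1 hd
      have := h2 u hu v hv fun h => hcd (by rw [h])
      simp only [← smul_sub, norm_smul]; norm_num; linarith
  let S : Set ℕ := {k | ∃ N, Sep N ∧ N.card = k}
  have hbdd : BddAbove S := ⟨5 ^ Module.finrank ℝ E, by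
    rintro _ ⟨N, hN, rfl⟩; exact hcard N hN⟩
  obtain ⟨N, hN, hNmax⟩ := Nat.sSup_mem (s := S) ⟨0, ∅, by simp [Sep], rfl⟩ hbdd
  refine ⟨N, hcard N hN, hN.1, fun x hx => ?_⟩
  by_contra! hfar
  have hxN : x ∉ N := fun h => by
    have := hfar x h
    simp at this
    linarith
  have hsep : Sep (insert x N) := by
    refine ⟨fun u hu => ?_, fun u hu v hv huv => ?_⟩
    · rcases Finset.mem_insert.1 hu with rfl | hu
      · exact hx
      · exact hN.1 u hu
    · rcases Finset.mem_insert.1 hu with rfl | hu' <;>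
        rcases Finset.mem_insert.1 hv with rfl | hv'
      · exact absurd rfl huv
      · exact (hfar v hv').le
      · rw [norm_sub_rev]; exact (hfar u hu').le
      · exact hN.2 u hu' v hv' huv
  have hle := le_csSup hbdd (show (insert x N).card ∈ S from ⟨_, hsep, rfl⟩)
  rw [Finset.card_insert_of_notMem hxN, ← hNmax] at hle
  omega

/-- Replacing `y / ‖y‖` by a net point loses at most `‖y‖ / 2`, which is absorbed. -/
lemma norm_le_two_mul_of_half_net {N : Finset E}
    (hN : ∀ x : E, ‖x‖ ≤ 1 → ∃ u ∈ N, ‖x - u‖ ≤ 1 / 2) {y : E} {c : ℝ}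
    (h : ∀ u ∈ N, inner ℝ u y ≤ c) : ‖y‖ ≤ 2 * c := by
  have hx : ‖‖y‖⁻¹ • y‖ ≤ 1 := by
    rw [norm_smul, norm_inv, norm_norm]; exact inv_mul_le_one
  obtain ⟨u, hu, hxu⟩ := hN _ hx
  have h1 : inner ℝ (‖y‖⁻¹ • y) y = ‖y‖ := by
    rw [real_inner_smul_left, real_inner_self_eq_norm_sq]
    rcases eq_or_ne ‖y‖ 0 with h0 | h0
    · rw [h0]; simp
    · field_simp
  have h2 : inner ℝ (‖y‖⁻¹ • y - u) y ≤ 1 / 2 * ‖y‖ :=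
    (real_inner_le_norm _ _).trans (mul_le_mul_of_nonneg_right hxu (norm_nonneg _))
  rw [inner_sub_left, h1] at h2
  linarith [h u hu]

/-- One factor `2` for the net in each argument of the bilinear form. -/
lemma opNorm_le_four_mul_of_half_net {N : Finset E}
    (hN : ∀ x : E, ‖x‖ ≤ 1 → ∃ u ∈ N, ‖x - u‖ ≤ 1 / 2) (T : E →L[ℝ] E) {c : ℝ} (hc : 0 ≤ c)
    (h : ∀ u ∈ N, ∀ v ∈ N, inner ℝ u (T v) ≤ c) : ‖T‖ ≤ 4 * c := by
  have key : ‖T‖ ≤ 2 * c + ‖T‖ * (1 / 2) := by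
    refine ContinuousLinearMap.opNorm_le_of_unit_norm (by positivity) fun x hx => ?_
    obtain ⟨v, hv, hxv⟩ := hN x hx.le
    have h1 := norm_le_two_mul_of_half_net hN fun u hu => h u hu v hv
    have h2 : ‖T (x - v)‖ ≤ ‖T‖ * (1 / 2) := T.le_opNorm_of_le hxv
    calc ‖T x‖ = ‖T v + T (x - v)‖ := by rw [← map_add, add_sub_cancel]
      _ ≤ _ := (norm_add_le _ _).trans (add_le_add h1 h2)
  linarith

end Net

/-! ### Operator norm of the Gaussian noise -/

section Noise

variable {n m : ℕ} {A : Fin m → Matrix (Fin n) (Fin n) ℝ}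

lemma frobInner_vecMulVec (W : Matrix (Fin n) (Fin n) ℝ) (u v : Fin n → ℝ) :
    frobInner W (vecMulVec u v) = u ⬝ᵥ (W *ᵥ v) := by
  simp only [frobInner_eq_sum, vecMulVec_apply, dotProduct, mulVec, Finset.mul_sum]
  exact Finset.sum_congr rfl fun i _ => Finset.sum_congr rfl fun j _ => by ring

lemma frobNorm_vecMulVec_sq (u v : EuclideanSpace ℝ (Fin n)) :
    frobNorm (vecMulVec u.ofLp v.ofLp) ^ 2 = ‖u‖ ^ 2 * ‖v‖ ^ 2 := by
  rw [frobNorm_sq, frobInner_eq_sum, EuclideanSpace.real_norm_sq_eq,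
    EuclideanSpace.real_norm_sq_eq, Finset.sum_mul_sum]
  simp only [vecMulVec_apply]
  exact Finset.sum_congr rfl fun i _ => Finset.sum_congr rfl fun j _ => by ring

variable {Ω : Type*} [MeasurableSpace Ω] {P : Measure Ω}

lemma hasSubgaussianMGF_of_hasLaw_gaussianReal {X : Ω → ℝ} {v : ℝ≥0}
    (h : HasLaw X (gaussianReal 0 v) P) : HasSubgaussianMGF X v P where
  integrable_exp_mul t := by
    have := integrable_exp_mul_gaussianReal (μ := 0) (v := v) t
    rw [← h.map_eq] at this
    exact this.comp_aemeasurable h.aemeasurable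
  mgf_le t := by rw [mgf_gaussianReal h.map_eq]; simp

lemma HasSubgaussianMGF.mono {X : Ω → ℝ} {c d : ℝ≥0} (h : HasSubgaussianMGF X c P)
    (hcd : c ≤ d) : HasSubgaussianMGF X d P where
  integrable_exp_mul := h.integrable_exp_mul
  mgf_le t := (h.mgf_le t).trans (Real.exp_le_exp.2 (by
    have : (c : ℝ) ≤ d := hcd
    gcongr))

variable {σ : ℝ≥0} {z : Fin m → Ω → ℝ}

lemma hasSubgaussianMGF_sum_mul [IsProbabilityMeasure P]
    (hz : ∀ i, HasLaw (z i) (gaussianReal 0 (σ ^ 2)) P)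
    (hind : iIndepFun z P) (c : Fin m → ℝ) {b : ℝ≥0} (hc : ∑ i, c i ^ 2 ≤ b) :
    HasSubgaussianMGF (fun ω => ∑ i, c i * z i ω) (b * σ ^ 2) P := by
  have h1 : iIndepFun (fun i ω => c i * z i ω) P :=
    hind.comp (fun i x => c i * x) fun i => measurable_const_mul _
  have h2 := HasSubgaussianMGF.sum_of_iIndepFun h1 (s := Finset.univ) fun i _ =>
    (hasSubgaussianMGF_of_hasLaw_gaussianReal (hz i)).const_mul (c i)
  refine HasSubgaussianMGF.mono h2 ?_
  rw [← NNReal.coe_le_coe, NNReal.coe_sum]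
  calc ∑ i, c i ^ 2 * (σ : ℝ) ^ 2 = (∑ i, c i ^ 2) * (σ : ℝ) ^ 2 := (Finset.sum_mul ..).symm
    _ ≤ b * (σ : ℝ) ^ 2 := mul_le_mul_of_nonneg_right hc (sq_nonneg _)
    _ = ((b * σ ^ 2 : ℝ≥0) : ℝ) := by push_cast; rfl

/-- The adjoint image of Gaussian noise has operator norm `O(√n σ)` with overwhelming
probability. -/
theorem measureReal_lt_opNorm_adjointMeasure_le [IsProbabilityMeasure P] {k : ℕ} (hk : 1 ≤ k)
    (hA : RestrictedIsometry A k 1) (hz : ∀ i, HasLaw (z i) (gaussianReal 0 (σ ^ 2)) P)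
    (hind : iIndepFun z P) :
    P.real {ω | 32 * √n * σ < opNorm (adjointMeasure A fun i => z i ω)} ≤ Real.exp (-n) := by
  -- The tail bound divides by the variance, so `σ = 0` is treated apart; there the noise vanishes
  -- almost surely.
  rcases eq_or_ne σ 0 with rfl | hσ
  · have hz0 : ∀ᵐ ω ∂P, ∀ i, z i ω = 0 := by
      rw [ae_all_iff]
      intro i
      have h := hasSubgaussianMGF_of_hasLaw_gaussianReal (hz i)
      rw [zero_pow two_ne_zero] at h
      exact h.ae_eq_zero_of_hasSubgaussianMGF_zero
    have hnull : P {ω | 32 * √n * ((0 : ℝ≥0) : ℝ) < opNorm (adjointMeasure A fun i => z i ω)} =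
        0 := by
      rw [measure_eq_zero_iff_ae_notMem]
      filter_upwards [hz0] with ω hω
      simp [hω, adjointMeasure, opNorm]
    rw [measureReal_def, hnull]
    simpa using Real.exp_nonneg _
  obtain ⟨N, hNcard, hN1, hNnet⟩ := exists_half_net (E := EuclideanSpace ℝ (Fin n))
  have hσ0 : (0 : ℝ) < σ := by exact_mod_cast pos_iff_ne_zero.2 hσ
  set c : EuclideanSpace ℝ (Fin n) → EuclideanSpace ℝ (Fin n) → Fin m → ℝ :=
    fun u v => measure A (vecMulVec u.ofLp v.ofLp) with hcdef
  have hc : ∀ u ∈ N, ∀ v ∈ N, ∑ i, c u v i ^ 2 ≤ (2 : ℝ≥0) := by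
    intro u hu v hv
    refine (hA _ ((Matrix.rank_vecMulVec_le _ _).trans hk)).2.trans ?_
    rw [frobNorm_vecMulVec_sq, ← mul_pow]
    have : ‖u‖ * ‖v‖ ≤ 1 := mul_le_one₀ (hN1 u hu) (norm_nonneg _) (hN1 v hv)
    have := pow_le_one₀ (n := 2) (by positivity) this
    push_cast
    linarith
  -- The variance proxy is `2σ²`, so the exponent is `(8√n σ)² / (2 · 2σ²) = 16n`.
  have htail : ∀ p ∈ N ×ˢ N, P.real {ω | 8 * √n * σ ≤ ∑ i, c p.1 p.2 i * z i ω} ≤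
      Real.exp (-(16 * n)) := by
    intro p hp
    obtain ⟨hp1, hp2⟩ := Finset.mem_product.1 hp
    refine ((hasSubgaussianMGF_sum_mul hz hind _ (hc _ hp1 _ hp2)).measure_ge_le
      (by positivity)).trans (le_of_eq ?_)
    congr 1
    push_cast
    rw [mul_pow, mul_pow, Real.sq_sqrt (Nat.cast_nonneg n)]
    field_simp
    ring
  have hsub : {ω | 32 * √n * σ < opNorm (adjointMeasure A fun i => z i ω)} ⊆
      ⋃ p ∈ N ×ˢ N, {ω | 8 * √n * σ ≤ ∑ i, c p.1 p.2 i * z i ω} := by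
    intro ω hω
    by_contra hcon
    simp only [Set.mem_iUnion, Set.mem_ofPred_eq, not_exists, not_le] at hcon
    refine not_lt.2 ?_ (Set.mem_ofPred_eq ▸ hω)
    have := opNorm_le_four_mul_of_half_net hNnet
      (Matrix.toEuclideanCLM (n := Fin n) (𝕜 := ℝ) (adjointMeasure A fun i => z i ω))
      (c := 8 * √n * σ) (by positivity) fun u hu v hv => by
        refine le_trans (le_of_eq ?_) (hcon (u, v) (Finset.mem_product.2 ⟨hu, hv⟩)).le
        simp only [mul_comm (c u v _)]
        rw [sum_mul_measure A (fun i => z i ω), frobInner_vecMulVec,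
          EuclideanSpace.inner_eq_star_dotProduct, dotProduct_comm]
        simp
    unfold opNorm
    linarith
  have hcard : ((N ×ˢ N).card : ℝ) ≤ 25 ^ n := by
    rw [finrank_euclideanSpace_fin] at hNcard
    rw [Finset.card_product]
    have h5 : N.card * N.card ≤ 25 ^ n := by
      calc N.card * N.card ≤ 5 ^ n * 5 ^ n := Nat.mul_le_mul hNcard hNcard
        _ = 25 ^ n := by rw [← mul_pow]; norm_num
    exact_mod_cast h5
  -- The `25ⁿ` pairs cost at most `e^{15n}`, leaving `e^{-n}`.
  have h25 : (25 : ℝ) ≤ Real.exp 15 := by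
    have h2 : (2 : ℝ) ≤ Real.exp 1 := by linarith [Real.add_one_le_exp (1 : ℝ)]
    calc (25 : ℝ) ≤ 2 ^ 15 := by norm_num
      _ ≤ Real.exp 1 ^ 15 := pow_le_pow_left₀ (by norm_num) h2 15
      _ = Real.exp 15 := by rw [← Real.exp_nat_mul]; norm_num
  calc P.real {ω | 32 * √n * σ < opNorm (adjointMeasure A fun i => z i ω)}
      ≤ P.real (⋃ p ∈ N ×ˢ N, {ω | 8 * √n * σ ≤ ∑ i, c p.1 p.2 i * z i ω}) :=
        measureReal_mono hsub (measure_ne_top _ _)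
    _ ≤ ∑ p ∈ N ×ˢ N, P.real {ω | 8 * √n * σ ≤ ∑ i, c p.1 p.2 i * z i ω} :=
        measureReal_biUnion_finset_le _ _
    _ ≤ (N ×ˢ N).card * Real.exp (-(16 * n)) := by
        rw [← nsmul_eq_mul]; exact Finset.sum_le_card_nsmul _ _ _ htail
    _ ≤ Real.exp 15 ^ n * Real.exp (-(16 * n)) := by
        refine mul_le_mul_of_nonneg_right (hcard.trans ?_) (Real.exp_nonneg _)
        exact pow_le_pow_left₀ (by norm_num) h25 n
    _ = Real.exp (-n) := by
        rw [← Real.exp_nat_mul, ← Real.exp_add]; congr 1; ring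

end Noise

end MatrixRecovery

/-! ### The recovery theorem -/

theorem theorem2p2 :
    ∃ K C D d : ℝ, 0 < K ∧ 0 < C ∧ 0 < D ∧ 0 < d ∧
      ∀ (n m r : ℕ), 1 ≤ r →
      ∀ (A : Fin m → Matrix (Fin n) (Fin n) ℝ) (δ : ℝ),
        MatrixRecovery.IsIsometryConstant A (4 * r) δ → δ < √2 - 1 →
      ∀ M : Matrix (Fin n) (Fin n) ℝ, M.rank = r →
      ∀ (σ : ℝ≥0) {Ω : Type*} [MeasurableSpace Ω] (P : Measure Ω) [IsProbabilityMeasure P]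
        (z : Fin m → Ω → ℝ),
        (∀ i, HasLaw (z i) (gaussianReal 0 (σ ^ 2)) P) → iIndepFun z P →
        ∃ E : Set Ω, MeasurableSet E ∧ 1 - D * Real.exp (-d * n) ≤ P.real E ∧
          ∀ ω ∈ E,
            (∃ Mhat, MatrixRecovery.IsDantzigSolution A
              (MatrixRecovery.measure A M + fun i => z i ω) (K * √n * σ) Mhat) ∧
            ∀ Mhat, MatrixRecovery.IsDantzigSolution A
              (MatrixRecovery.measure A M + fun i => z i ω) (K * √n * σ) Mhat →
              MatrixRecovery.frobNorm (Mhat - M) ^ 2 ≤ C * n * r * (σ : ℝ) ^ 2 := by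
  -- `32` is the net factor `4` times the threshold `8`; `1000` is `250` times the square of the `2`
  -- in `2λ`.
  refine ⟨32, 1000 * 32 ^ 2, 1, 1, by norm_num, by norm_num, one_pos, one_pos, ?_⟩
  intro n m r hr A δ hδ hδlt M hM σ Ω _ P _ z hz hind
  -- Rounding `√2 - 1` up to `0.4143` gives one fixed isometry constant, so that `C` is absolute.
  have hsqrt : √2 ≤ 1.4143 := Real.sqrt_le_iff.2 ⟨by norm_num, by norm_num⟩
  have hA : MatrixRecovery.RestrictedIsometry A (4 * r) δ := hδ.1
  have hA1 : MatrixRecovery.RestrictedIsometry A (4 * r) 0.4143 :=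
    hA.mono (by norm_num at hsqrt ⊢; linarith)
  set B : Set Ω :=
    {ω | 32 * √n * σ < MatrixRecovery.opNorm (MatrixRecovery.adjointMeasure A fun i => z i ω)}
    with hB
  have hPB : P.real B ≤ Real.exp (-n) :=
    MatrixRecovery.measureReal_lt_opNorm_adjointMeasure_le (by omega)
      (hA1.mono (by norm_num)) hz hind
  -- The `z i` are only almost everywhere measurable, so the bad event is replaced by a measurable
  -- hull of equal measure.
  refine ⟨(toMeasurable P B)ᶜ, (measurableSet_toMeasurable P B).compl, ?_, fun ω hω => ?_⟩
  · rw [probReal_compl_eq_one_sub (measurableSet_toMeasurable P B), measureReal_def,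
      measure_toMeasurable, ← measureReal_def]
    simp only [one_mul, neg_mul]
    linarith
  have hnoise : MatrixRecovery.opNorm (MatrixRecovery.adjointMeasure A fun i => z i ω) ≤
      32 * √n * σ := not_lt.1 fun h => hω (subset_toMeasurable P B h)
  refine ⟨MatrixRecovery.exists_isDantzigSolution A _ _ (M := M) ?_, fun X hX => ?_⟩
  · simpa [MatrixRecovery.DantzigFeasible] using hnoise
  · refine (hX.frobNorm_sub_sq_le hr hA1 hM.le hnoise).trans (le_of_eq ?_)
    rw [mul_pow, mul_pow, Real.sq_sqrt (Nat.cast_nonneg n)]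
    ring
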